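/- Equip the category of simplicial groups with the model structure transferred from the Kan--Quillen model structure on simplicial sets along the free group / forgetful adjunction $F \dashv U$: a map $g$ of simplicial groups is a weak equivalence (resp. a fibration) if and only if $U(g)$ is a weak equivalence (resp. a Kan fibration) of simplicial sets, and the cofibrations are the maps having the left lifting property with respect to all maps that are both fibrations and weak equivalences. If $f : G \to H$ is a cofibration of simplicial groups, then $U(f) : U(G) \to U(H)$ is a cofibration of simplicial sets, i.e. a monomorphism. -/

import Mathlib

open CategoryTheory HomotopicalAlgebra

open scoped SSet.modelCategoryQuillen

universe u

namespace SSet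

/-- The set `[X, K]` of maps of simplicial sets up to simplicial homotopy: the quotient of
`X ⟶ K` by the equivalence relation generated by the existence of a homotopy
`X ⊗ Δ[1] ⟶ K`, in other words the connected components of the mapping space. -/
def HtpyClasses (X K : SSet.{u}) : Type u :=
  Quot (fun g h : X ⟶ K => Nonempty (SSet.Homotopy g h))

/-- Precomposition with `f : X ⟶ Y` preserves homotopies. -/
theorem nonempty_homotopy_precomp {X Y K : SSet.{u}} (f : X ⟶ Y) {g h : Y ⟶ K}
    (H : Nonempty (SSet.Homotopy g h)) : Nonempty (SSet.Homotopy (f ≫ g) (f ≫ h)) := by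
  obtain ⟨H⟩ := H
  exact ⟨RelativeMorphism.Homotopy.precomp H (RelativeMorphism.botEquiv.symm f)
    (Subcomplex.isInitialBot.hom_ext _ _)⟩

/-- The map `[Y, K] → [X, K]` induced by `f : X ⟶ Y`. -/
def HtpyClasses.precomp {X Y : SSet.{u}} (f : X ⟶ Y) (K : SSet.{u}) :
    HtpyClasses Y K → HtpyClasses X K :=
  Quot.map (fun g => f ≫ g) (fun _ _ H => nonempty_homotopy_precomp f H)

/-- The weak equivalences of the Kan-Quillen model structure on simplicial sets: the maps
`f : X ⟶ Y` such that `[Y, K] → [X, K]` is bijective for every Kan complex `K`. -/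
instance kanQuillenWeakEquivalences : CategoryWithWeakEquivalences SSet.{u} where
  weakEquivalences := fun _ _ f =>
    ∀ K : SSet.{u}, KanComplex K → Function.Bijective (HtpyClasses.precomp f K)

end SSet

/-- The category of simplicial groups. -/
abbrev SGrp : Type (u + 1) := SimplicialObject GrpCat.{u}

namespace SGrp

/-- The functor sending a simplicial group to its underlying simplicial set. -/
abbrev U : SGrp.{u} ⥤ SSet.{u} :=
  (SimplicialObject.whiskering GrpCat.{u} (Type u)).obj (forget GrpCat.{u})

/-- In the transferred model structure, a map of simplicial groups is a weak equivalence iff the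
underlying map of simplicial sets is one. -/
instance transferredWeakEquivalences : CategoryWithWeakEquivalences SGrp.{u} where
  weakEquivalences := (weakEquivalences SSet.{u}).inverseImage U

/-- In the transferred model structure, a map of simplicial groups is a fibration iff the
underlying map of simplicial sets is a (Kan) fibration. -/
instance transferredFibrations : CategoryWithFibrations SGrp.{u} where
  fibrations := (fibrations SSet.{u}).inverseImage U

/-- In the transferred model structure (as in any model structure), the cofibrations are the maps
with the left lifting property against all maps that are both fibrations and weak equivalences. -/
instance transferredCofibrations : CategoryWithCofibrations SGrp.{u} where
  cofibrations := (trivialFibrations SGrp.{u}).llp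

end SGrp

open Opposite MonoidalCategory CartesianMonoidalCategory Simplicial

namespace SSet

/-! Every simplicial group `G` embeds, by a homomorphism, in the simplicial group `cofree G.obj`.
Simplicial maps into a cofree object are arbitrary levelwise families of functions, so they extend
along monomorphisms and any two are homotopic. Hence `cofree G.obj` maps to the trivial group by a
trivial fibration. A cofibration `f : G ⟶ H` lifts against it, so the embedding of `G` factors
through `f`, and `f` is injective in each degree. -/

/-- A map `p` with a section `s` such that `p ≫ s` is homotopic to the identity induces bijections
on sets of homotopy classes of maps. -/
theorem bijective_htpyClasses_precomp_of_homotopyInverse {X Y : SSet.{u}} (p : X ⟶ Y) (s : Y ⟶ X)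
    (hsp : s ≫ p = 𝟙 Y) (H : Homotopy (𝟙 X) (p ≫ s)) (K : SSet.{u}) :
    Function.Bijective (HtpyClasses.precomp p K) := by
  refine Function.bijective_iff_has_inverse.2 ⟨HtpyClasses.precomp s K, ?_, ?_⟩
  · rintro ⟨g⟩
    change Quot.mk _ (s ≫ p ≫ g) = Quot.mk _ g
    rw [← Category.assoc, hsp, Category.id_comp]
  · rintro ⟨g⟩
    refine (Quot.sound ⟨?_⟩ : Quot.mk _ g = Quot.mk _ (p ≫ s ≫ g)).symm
    exact
      { h := H.h ≫ g
        h₀ := by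
          rw [← Category.assoc, H.h₀, Category.id_comp]; rfl
        h₁ := by
          rw [← Category.assoc, H.h₁, Category.assoc]; rfl
        rel := by
          ext n x
          exact x.1.2.elim }

end SSet

namespace SGrp

/-- The cofree simplicial group on a family of groups indexed by the simplices: a map from a
simplicial set (or group) `X` to it is a family of maps (or homomorphisms) `X.obj n → A n`,
with no compatibility between the different `n`. -/
def cofree (A : SimplexCategoryᵒᵖ → GrpCat.{u}) : SGrp.{u} where
  obj m := GrpCat.of (∀ n, (m ⟶ n) → A n)
  map α := GrpCat.ofHom
    { toFun := fun s n φ => s n (α ≫ φ)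
      map_one' := rfl
      map_mul' := fun _ _ => rfl }
  map_id m := by
    ext s n φ
    change s n (𝟙 m ≫ φ) = s n φ
    rw [Category.id_comp]
  map_comp α β := by
    ext s n φ
    change s n ((α ≫ β) ≫ φ) = s n (α ≫ β ≫ φ)
    rw [Category.assoc]

/-- A simplicial group embeds in the cofree simplicial group on its groups of simplices. -/
def toCofree (G : SGrp.{u}) : G ⟶ cofree G.obj where
  app m := GrpCat.ofHom
    { toFun := fun x n φ => G.map φ x
      map_one' := by funext n φ; exact map_one (G.map φ).hom
      map_mul' := fun x y => by funext n φ; exact map_mul (G.map φ).hom x y }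
  naturality m m' α := by
    ext x
    funext n φ
    exact (ConcreteCategory.congr_hom (G.map_comp α φ) x).symm

theorem toCofree_injective (G : SGrp.{u}) (m : SimplexCategoryᵒᵖ) :
    Function.Injective ((U.map (toCofree G)).app m) := by
  intro x y h
  have h' : G.map (𝟙 m) x = G.map (𝟙 m) y := congrFun (congrFun h m) (𝟙 m)
  rw [G.map_id] at h'
  exact h'

variable {A : SimplexCategoryᵒᵖ → GrpCat.{u}}

/-- The map of simplicial sets to a cofree simplicial group induced by a family of maps. -/
def cofreeLift {X : SSet.{u}} (g : ∀ n, X.obj n → A n) : X ⟶ U.obj (cofree A) where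
  app m := ↾fun x n φ => g n (X.map φ x)
  naturality m m' α := by
    ext x
    funext n φ
    exact congrArg (g n) (ConcreteCategory.congr_hom (X.map_comp α φ) x).symm

/-- By naturality, the coordinate at `φ` is the identity coordinate at the face or degeneracy `X.map
φ x`. -/
theorem cofree_hom_ext {X : SSet.{u}} {g h : X ⟶ U.obj (cofree A)}
    (H : ∀ n x, g.app n x n (𝟙 n) = h.app n x n (𝟙 n)) : g = h := by
  have eval (k : X ⟶ U.obj (cofree A)) {m n} (x : X.obj m) (φ : m ⟶ n) : k.app n (X.map φ x) n (𝟙 n) = k.app m x n φ := by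
    have := congrFun (congrFun (ConcreteCategory.congr_hom (k.naturality φ) x) n) (𝟙 n)
    refine this.trans ?_
    change k.app m x n (φ ≫ 𝟙 n) = _
    rw [Category.comp_id]
  ext m x
  funext n φ
  exact (eval g x φ).symm.trans ((H n _).trans (eval h x φ))

theorem cofreeLift_app {X : SSet.{u}} (g : ∀ n, X.obj n → A n) (n) (x : X.obj n) :
    (cofreeLift g).app n x n (𝟙 n) = g n x := by
  change g n (X.map (𝟙 n) x) = g n x
  rw [X.map_id]
  rfl

theorem exists_extension_cofree {X Y : SSet.{u}} (i : X ⟶ Y) [Mono i]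
    (g : X ⟶ U.obj (cofree A)) : ∃ h : Y ⟶ U.obj (cofree A), i ≫ h = g := by
  refine ⟨cofreeLift fun n => Function.extend (i.app n) (fun x => g.app n x n (𝟙 n)) 1, ?_⟩
  refine cofree_hom_ext fun n x => ?_
  refine (cofreeLift_app (fun n => Function.extend (i.app n)
    (fun x => g.app n x n (𝟙 n)) 1) n (i.app n x)).trans ?_
  exact ((mono_iff_injective _).1 (inferInstanceAs (Mono (i.app n)))).extend_apply _ _ x

theorem nonempty_homotopy_cofree {X : SSet.{u}} (g h : X ⟶ U.obj (cofree A)) :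
    Nonempty (SSet.Homotopy g h) := by
  classical
  -- Use `g` where the `Δ[1]` component is constant at vertex 0 and `h` on all other simplices; no
  -- compatibility between degrees is needed.
  let e (n) (x : (X ⊗ Δ[1] : SSet.{u}).obj n) : A n :=
    if x.2 = (SSet.const (SSet.stdSimplex.obj₀Equiv.{u}.symm 0)).app n x.2 then
      g.app n x.1 n (𝟙 n) else h.app n x.1 n (𝟙 n)
  have hne (n) (x : X.obj n) :
      (SSet.ι₁.app n x).2 ≠ (SSet.const (SSet.stdSimplex.obj₀Equiv.{u}.symm 0) : Δ[1] ⟶ Δ[1]).app n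
        (SSet.ι₁.app n x).2 := by
    obtain ⟨n⟩ := n
    induction n using SimplexCategory.rec with | _ n =>
    intro H
    have := DFunLike.congr_fun H (0 : Fin (n + 1))
    exact one_ne_zero (α := Fin 2) this
  exact ⟨{ h := cofreeLift e
           h₀ := cofree_hom_ext fun n x =>
            (cofreeLift_app e n (SSet.ι₀.app n x)).trans (if_pos rfl)
           h₁ := cofree_hom_ext fun n x =>
            (cofreeLift_app e n (SSet.ι₁.app n x)).trans (if_neg (hne n x))
           rel := by
             ext n x
             exact x.1.2.elim }⟩

/-- The trivial simplicial group, as a cofree simplicial group. -/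
abbrev trivial : SGrp.{u} := cofree fun _ => GrpCat.of PUnit

theorem hom_trivial_ext {X : SSet.{u}} (g h : X ⟶ U.obj trivial) : g = h :=
  cofree_hom_ext fun _ _ => rfl

theorem trivialFibrations_of_cofree (p : cofree A ⟶ trivial) : trivialFibrations SGrp.{u} p := by
  refine ⟨?_, ?_⟩
  · change SSet.modelCategoryQuillen.J.rlp (U.map p)
    intro X Y i hi
    have : Mono i := SSet.modelCategoryQuillen.J_le_monomorphisms _ hi
    refine ⟨fun {t b} sq => ?_⟩
    obtain ⟨l, hl⟩ := exists_extension_cofree i t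
    exact ⟨⟨{ l := l, fac_left := hl, fac_right := hom_trivial_ext _ _ }⟩⟩
  · intro K _
    -- The section picks the unit; its composite with the projection is homotopic to the identity,
    -- as any two maps into a cofree object are.
    exact SSet.bijective_htpyClasses_precomp_of_homotopyInverse _ (cofreeLift fun _ _ => 1)
      (hom_trivial_ext _ _) (nonempty_homotopy_cofree _ _).some K

end SGrp

theorem mainTheorem11 {G H : SGrp.{u}} (f : G ⟶ H) (hf : Cofibration f) :
    Cofibration (SGrp.U.map f) := by
  let p (K : SGrp.{u}) : K ⟶ SGrp.trivial :=
    { app := fun _ => 1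
      naturality := fun _ _ _ => rfl }
  have := hf.mem _ (SGrp.trivialFibrations_of_cofree (p (SGrp.cofree G.obj)))
  have sq : CommSq (SGrp.toCofree G) f (p _) (p H) := ⟨rfl⟩
  rw [SSet.modelCategoryQuillen.cofibration_iff, NatTrans.mono_iff_mono_app]
  intro m
  rw [mono_iff_injective]
  have fac : SGrp.U.map f ≫ SGrp.U.map sq.lift = SGrp.U.map (SGrp.toCofree G) := by
    rw [← Functor.map_comp, sq.fac_left]
  have := SGrp.toCofree_injective G m
  rw [← fac] at this
  exact Function.Injective.of_comp this
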